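/- Logarithms are in base $2$. The size of a rational number $p/q$, with $p,q$ relatively prime integers and $q>0$, is $\mathrm{size}(p/q)=1+\lceil\log(|p|+1)\rceil+\lceil\log(q+1)\rceil$, and the size of a vector $a\in\mathbb{Q}^d$ is $\mathrm{size}(a)=d+\sum_{i=1}^d\mathrm{size}(a_i)$. A rational polytope in $\mathbb{R}^d$ is the convex hull of a non-empty finite set of points with rational coordinates. For a rational polytope $P\subset\mathbb{R}^d$, the vertex complexity $\nu(P)$ is the smallest integer $\nu\geq d$ such that every vertex of $P$ has size at most $\nu$, and the facet complexity $\varphi(P)$ is the smallest integer $\varphi\geq d$ such that $P=\{x\in\mathbb{R}^d: a^i\cdot x\leq b_i \text{ for } 1\leq i\leq n\}$ for some $n$, some $a^1,\ldots,a^n\in\mathbb{Q}^d$ and some $b_1,\ldots,b_n\in\mathbb{Q}$ with $\mathrm{size}(a^i)+\mathrm{size}(b_i)\leq\varphi$ for all $i$. Write $\nu(P,Q)=\max\{\nu(P),\nu(Q)\}$, $\varphi(P,Q)=\max\{\varphi(P),\varphi(Q)\}$, and let $d(P,Q)$ be the Euclidean distance between $P$ and $Q$. **Theorem.** Let $\alpha\in\,]0,1[$.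 There exist two disjoint rational polytopes $P$ and $Q$ (in a common space $\mathbb{R}^d$, where $d$ may depend on the pair) with arbitrarily large $\nu(P,Q)$ and $\varphi(P,Q)$ such that $$ d(P,Q)\leq\frac{1}{\left(\frac{\nu(P,Q)}{4}\right)^{(1-\alpha)\left(\frac{\nu(P,Q)}{4}\right)^{\alpha}}} \qquad\text{and}\qquad d(P,Q)\leq\frac{1}{\left(\frac{\varphi(P,Q)}{16}\right)^{\frac{1-\alpha}{3}\left(\frac{\varphi(P,Q)}{16}\right)^{\alpha/3}}}\,. $$ That is, for every integer $N$ there is such a pair with $\nu(P,Q)\geq N$ and $\varphi(P,Q)\geq N$ that satisfies both inequalities. Moreover, $P$ and $Q$ can be chosen to be $0/1$-polytopes, i.e. all the coordinates of all their vertices belong to $\{0,1\}$. -/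

import Mathlib

/-- The size of a rational number `α / β` in lowest terms with `β > 0`:
`1 + ⌈log₂ (|α| + 1)⌉ + ⌈log₂ (β + 1)⌉` (`Nat.clog 2` is the ceiling of the binary logarithm). -/
def ratSize (q : ℚ) : ℕ :=
  1 + Nat.clog 2 (q.num.natAbs + 1) + Nat.clog 2 (q.den + 1)

/-- The size of a rational vector: the number of its coordinates plus the sum of their sizes. -/
def vecSize {d : ℕ} (a : Fin d → ℚ) : ℕ :=
  d + ∑ i, ratSize (a i)

/-- The point of the Euclidean space `ℝ^d` with the given rational coordinates. -/
noncomputable def ratPoint {d : ℕ} (v : Fin d → ℚ) : EuclideanSpace ℝ (Fin d) :=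
  WithLp.toLp 2 (fun i => (v i : ℝ))

/-- A (non-empty) rational polytope: the convex hull of finitely many, and at least one, points
with rational coordinates. -/
def IsRationalPolytope {d : ℕ} (P : Set (EuclideanSpace ℝ (Fin d))) : Prop :=
  ∃ V : Finset (Fin d → ℚ), V.Nonempty ∧
    P = convexHull ℝ (ratPoint '' (V : Set (Fin d → ℚ)))

/-- The vertices (extreme points) of `P` all have their coordinates in `{0, 1}`. -/
def HasZeroOneVertices {d : ℕ} (P : Set (EuclideanSpace ℝ (Fin d))) : Prop :=
  ∀ x ∈ P.extremePoints ℝ, ∀ i, x i = 0 ∨ x i = 1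

/-- The vertex complexity of `P`: the smallest `n ≥ d` such that every vertex of `P` is a rational
point of size at most `n`. -/
noncomputable def vertexComplexity {d : ℕ} (P : Set (EuclideanSpace ℝ (Fin d))) : ℕ :=
  sInf {n : ℕ | d ≤ n ∧ ∀ x ∈ P.extremePoints ℝ, ∃ v : Fin d → ℚ, ratPoint v = x ∧ vecSize v ≤ n}

/-- The facet complexity of `P`: the smallest `n ≥ d` such that `P` is the solution set of a finite
system of rational linear inequalities `a i ⬝ x ≤ b i` with `size (a i) + size (b i) ≤ n`. -/
noncomputable def facetComplexity {d : ℕ} (P : Set (EuclideanSpace ℝ (Fin d))) : ℕ :=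
  sInf {n : ℕ | d ≤ n ∧ ∃ (m : ℕ) (a : Fin m → Fin d → ℚ) (b : Fin m → ℚ),
    P = {x : EuclideanSpace ℝ (Fin d) | ∀ i, ∑ j, (a i j : ℝ) * x j ≤ (b i : ℝ)} ∧
    ∀ i, vecSize (a i) + ratSize (b i) ≤ n}

/-- `ν(P, Q)`. -/
noncomputable def pairVertexComplexity {d : ℕ} (P Q : Set (EuclideanSpace ℝ (Fin d))) : ℕ :=
  max (vertexComplexity P) (vertexComplexity Q)

/-- `φ(P, Q)`. -/
noncomputable def pairFacetComplexity {d : ℕ} (P Q : Set (EuclideanSpace ℝ (Fin d))) : ℕ :=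
  max (facetComplexity P) (facetComplexity Q)

/-- The Euclidean distance `d(P, Q)` between two (non-empty) sets: the infimum of the distances
between a point of `P` and a point of `Q`. -/
noncomputable def setDist {d : ℕ} (P Q : Set (EuclideanSpace ℝ (Fin d))) : ℝ :=
  sInf (Set.image2 dist P Q)

/-! Let `a` range over the standard simplex of `ℝ^(m+1)`, and let `P` consist of the points `(a, a)`
and `Q` of the points `(a, b)` with `b k` the sum of the `a i` for `i < k`. A common point would
satisfy `a k = ∑ i < k, a i` for all `k`, so `a = 0`, which is not in the simplex
(`disjoint_graphVertex_eq_lt`). But the weights proportional to `1, 1, 2, 4, ...` satisfy every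
equation except the one for `k = 0`, which fails by only `1 / 2 ^ m`
(`setDist_graphVertex_eq_lt_le`). Both polytopes are 0/1-simplices cut out by inequalities with
coefficients in `{-1, 0, 1}`, so both complexities are linear in the dimension `d = 2 * m + 2`.
Since `2 ^ m` eventually exceeds `d ^ (d ^ α)`, both bounds follow. -/

open Filter in
/-- Exponential functions eventually dominate `d ^ (d ^ α)` for `α < 1`. -/
theorem eventually_rpow_rpow_le_two_pow {α : ℝ} (hα : α < 1) :
    ∀ᶠ m : ℕ in atTop, ((2 * m + 2 : ℕ) : ℝ) ^ (((2 * m + 2 : ℕ) : ℝ) ^ α) ≤ (2 : ℝ) ^ m := by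
  -- The constant `log 2 / 4` is what `2 * m + 2 ≤ 4 * m` (for `m ≥ 1`) requires to end at `m * log
  -- 2`.
  have h := (isLittleO_log_rpow_atTop (sub_pos.2 hα)).bound
    (show (0 : ℝ) < Real.log 2 / 4 by positivity)
  have ht : Tendsto (fun m : ℕ => ((2 * m + 2 : ℕ) : ℝ)) atTop atTop :=
    tendsto_natCast_atTop_atTop.comp (tendsto_atTop_mono (fun m => (by omega : m ≤ 2 * m + 2)) tendsto_id)
  filter_upwards [ht.eventually h, eventually_ge_atTop 1] with m hm h1
  set x : ℝ := ((2 * m + 2 : ℕ) : ℝ) with hx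
  have hxm : x ≤ 4 * m := by
    rw [hx]; exact_mod_cast (by omega : 2 * m + 2 ≤ 4 * m)
  have hx0 : 0 < x := by rw [hx]; positivity
  have hlog : Real.log x ≤ Real.log 2 / 4 * x ^ (1 - α) := by
    refine (le_abs_self _).trans (hm.trans_eq ?_)
    rw [Real.norm_of_nonneg (by positivity)]
  rw [← Real.log_le_log_iff (by positivity) (by positivity), Real.log_rpow hx0, Real.log_pow]
  calc x ^ α * Real.log x ≤ x ^ α * (Real.log 2 / 4 * x ^ (1 - α)) := by gcongr
    _ = Real.log 2 / 4 * x := by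
      rw [mul_left_comm, ← Real.rpow_add hx0]; simp
    _ ≤ Real.log 2 / 4 * (4 * m) := by gcongr
    _ = m * Real.log 2 := by ring

/-- Reduces both target bounds to `d ^ (d ^ α)`: the factors `1 - α` and `(1 - α) / 3` are only used
as being at most `1`, and `α / 3` as lying in `[0, α]`. -/
theorem rpow_mul_rpow_le_rpow_rpow {x d c α β : ℝ} (hx : 1 ≤ x) (hxd : x ≤ d) (hc : c ≤ 1)
    (hβ : 0 ≤ β) (hβα : β ≤ α) : x ^ (c * x ^ β) ≤ d ^ (d ^ α) := by
  have hd : 1 ≤ d := hx.trans hxd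
  have hx0 : 0 < x := by linarith
  calc x ^ (c * x ^ β) ≤ x ^ (d ^ α) := by
        refine Real.rpow_le_rpow_of_exponent_le hx ?_
        calc c * x ^ β ≤ 1 * x ^ β := by gcongr
          _ ≤ d ^ β := by rw [one_mul]; gcongr
          _ ≤ d ^ α := Real.rpow_le_rpow_of_exponent_le hd hβα
    _ ≤ d ^ (d ^ α) := by gcongr

theorem ratSize_intCast_le {z : ℤ} (hz : |z| ≤ 1) : ratSize (z : ℚ) ≤ 3 := by
  have h2 : Nat.clog 2 2 = 1 := by decide
  have h1 : Nat.clog 2 (z.natAbs + 1) ≤ 1 := by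
    refine (Nat.clog_mono_right 2 (show z.natAbs + 1 ≤ 2 by rw [abs_le] at hz; omega)).trans h2.le
  simp only [ratSize, Rat.num_intCast, Rat.den_intCast]
  norm_num [h2]
  omega

theorem vecSize_intCast_le {d : ℕ} {a : Fin d → ℤ} (ha : ∀ j, |a j| ≤ 1) :
    vecSize (fun j => (a j : ℚ)) ≤ 4 * d := by
  have h : ∑ j, ratSize (a j : ℚ) ≤ ∑ _j : Fin d, 3 :=
    Finset.sum_le_sum fun j _ => ratSize_intCast_le (ha j)
  rw [Finset.sum_const, Finset.card_univ, Fintype.card_fin, smul_eq_mul] at h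
  calc d + ∑ j, ratSize (a j : ℚ) ≤ d + d * 3 := by gcongr
    _ = 4 * d := by ring

/-! ### Lattice polytopes and bounds on their complexities -/

section Polytope

variable {d : ℕ} {κ : Type*}

/-- The polytope spanned by a finite family of integer points. -/
noncomputable def latticePolytope (v : κ → Fin d → ℤ) : Set (EuclideanSpace ℝ (Fin d)) :=
  convexHull ℝ (Set.range fun i => ratPoint fun j => (v i j : ℚ))

theorem mem_latticePolytope [Fintype κ] {v : κ → Fin d → ℤ} {x : EuclideanSpace ℝ (Fin d)} :
    x ∈ latticePolytope v ↔
      ∃ w : κ → ℝ, (∀ i, 0 ≤ w i) ∧ ∑ i, w i = 1 ∧ ∀ j, x j = ∑ i, w i * v i j := by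
  classical
  constructor
  · intro hx
    have hsub : latticePolytope v ⊆ {x : EuclideanSpace ℝ (Fin d) |
        ∃ w : κ → ℝ, (∀ i, 0 ≤ w i) ∧ ∑ i, w i = 1 ∧ ∀ j, x j = ∑ i, w i * v i j} := by
      refine convexHull_min ?_ ?_
      · rintro _ ⟨i, rfl⟩
        refine ⟨Pi.single i 1, fun k => ?_, by simp, fun j => ?_⟩
        · by_cases h : k = i
          · subst h; simp
          · simp [h]
        · simp [ratPoint, Pi.single_apply]
      · rintro x ⟨w, hw, hw1, hx⟩ y ⟨u, hu, hu1, hy⟩ a b ha hb hab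
        refine ⟨fun i => a * w i + b * u i, fun i => ?_, ?_, fun j => ?_⟩
        · have := hw i; have := hu i; positivity
        · rw [Finset.sum_add_distrib, ← Finset.mul_sum, ← Finset.mul_sum, hw1, hu1]; linarith
        · simp only [PiLp.add_apply, PiLp.smul_apply, smul_eq_mul, hx, hy, Finset.mul_sum,
            ← Finset.sum_add_distrib]
          exact Finset.sum_congr rfl fun i _ => by ring
    exact hsub hx
  · rintro ⟨w, hw, hw1, hx⟩
    refine mem_convexHull_of_exists_fintype w
      (fun i => ratPoint fun j => (v i j : ℚ)) hw hw1 (fun i => ⟨i, rfl⟩) ?_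
    ext j
    simp [ratPoint, hx]

theorem isRationalPolytope_latticePolytope [Fintype κ] [Nonempty κ] (v : κ → Fin d → ℤ) :
    IsRationalPolytope (latticePolytope v) := by
  classical
  refine ⟨Finset.univ.image fun i j => (v i j : ℚ), Finset.univ_nonempty.image _, ?_⟩
  rw [latticePolytope, Finset.coe_image, ← Set.image_comp, Finset.coe_univ, Set.image_univ]
  rfl

theorem exists_eq_of_mem_extremePoints_latticePolytope {v : κ → Fin d → ℤ}
    {x : EuclideanSpace ℝ (Fin d)} (hx : x ∈ (latticePolytope v).extremePoints ℝ) :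
    ∃ i, ratPoint (fun j => (v i j : ℚ)) = x :=
  Set.mem_range.1 (extremePoints_convexHull_subset hx)

theorem hasZeroOneVertices_latticePolytope {v : κ → Fin d → ℤ}
    (hv : ∀ i j, v i j = 0 ∨ v i j = 1) : HasZeroOneVertices (latticePolytope v) := by
  intro x hx j
  obtain ⟨i, rfl⟩ := exists_eq_of_mem_extremePoints_latticePolytope hx
  rcases hv i j with h | h <;> simp [ratPoint, h]

theorem vertexComplexity_latticePolytope_mem_Icc {v : κ → Fin d → ℤ} (hv : ∀ i j, |v i j| ≤ 1) :
    vertexComplexity (latticePolytope v) ∈ Set.Icc d (4 * d) := by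
  have h : 4 * d ∈ {n : ℕ | d ≤ n ∧ ∀ x ∈ (latticePolytope v).extremePoints ℝ,
      ∃ u : Fin d → ℚ, ratPoint u = x ∧ vecSize u ≤ n} := by
    refine ⟨by omega, fun x hx => ?_⟩
    obtain ⟨i, hi⟩ := exists_eq_of_mem_extremePoints_latticePolytope hx
    exact ⟨_, hi, vecSize_intCast_le (hv i)⟩
  exact ⟨(Nat.sInf_mem ⟨_, h⟩).1, Nat.sInf_le h⟩

/-- If a lattice polytope is cut out by its valid inequalities with coefficients in `{-1, 0, 1}`,
then its facet complexity is at most `4 * d + 3`. -/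
theorem facetComplexity_latticePolytope_mem_Icc [Fintype κ] {v : κ → Fin d → ℤ}
    (hP : ∀ x : EuclideanSpace ℝ (Fin d),
      (∀ (a : Fin d → ℤ) (b : ℤ), (∀ j, |a j| ≤ 1) → |b| ≤ 1 →
        (∀ i, ∑ j, a j * v i j ≤ b) → ∑ j, (a j : ℝ) * x j ≤ b) → x ∈ latticePolytope v) :
    facetComplexity (latticePolytope v) ∈ Set.Icc d (4 * d + 3) := by
  classical
  -- Taking all valid inequalities with small coefficients, a finite set, avoids listing the facets.
  let S : Set ((Fin d → ℤ) × ℤ) := {p | (∀ j, |p.1 j| ≤ 1) ∧ |p.2| ≤ 1 ∧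
    ∀ i, ∑ j, p.1 j * v i j ≤ p.2}
  have hS : S.Finite := by
    refine (Set.finite_Icc ((fun _ => -1, -1) : (Fin d → ℤ) × ℤ) (fun _ => 1, 1)).subset ?_
    rintro ⟨a, b⟩ ⟨ha, hb, -⟩
    exact ⟨⟨fun j => (abs_le.1 (ha j)).1, (abs_le.1 hb).1⟩,
      ⟨fun j => (abs_le.1 (ha j)).2, (abs_le.1 hb).2⟩⟩
  have : Fintype S := hS.fintype
  let e := Fintype.equivFin S
  have h : 4 * d + 3 ∈ {n : ℕ | d ≤ n ∧ ∃ (m : ℕ) (a : Fin m → Fin d → ℚ) (b : Fin m → ℚ),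
      latticePolytope v =
        {x : EuclideanSpace ℝ (Fin d) | ∀ i, ∑ j, (a i j : ℝ) * x j ≤ (b i : ℝ)} ∧
      ∀ i, vecSize (a i) + ratSize (b i) ≤ n} := by
    refine ⟨by omega, _, fun k j => ((e.symm k).1.1 j : ℚ), fun k => ((e.symm k).1.2 : ℚ), ?_,
      fun k => ?_⟩
    · ext x
      refine ⟨fun hx k => ?_, fun hx => hP x fun a b ha hb hab => ?_⟩
      · obtain ⟨w, hw, hw1, hxw⟩ := mem_latticePolytope.1 hx
        have hab := (e.symm k).2.2.2
        simp only [Rat.cast_intCast]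
        generalize (e.symm k).1.1 = a at hab ⊢
        generalize (e.symm k).1.2 = b at hab ⊢
        calc ∑ j, (a j : ℝ) * x j = ∑ i, w i * ∑ j, (a j : ℝ) * v i j := by
              simp only [hxw, Finset.mul_sum]
              rw [Finset.sum_comm]
              exact Finset.sum_congr rfl fun i _ => Finset.sum_congr rfl fun j _ => by ring
          _ ≤ ∑ i, w i * b := by
              refine Finset.sum_le_sum fun i _ => mul_le_mul_of_nonneg_left ?_ (hw i)
              exact_mod_cast hab i
          _ = b := by rw [← Finset.sum_mul, hw1, one_mul]
      · simpa using hx (e ⟨(a, b), ha, hb, hab⟩)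
    · have h1 := vecSize_intCast_le (e.symm k).2.1
      have h2 := ratSize_intCast_le (e.symm k).2.2.1
      exact add_le_add h1 h2
  exact ⟨(Nat.sInf_mem ⟨_, h⟩).1, Nat.sInf_le h⟩

end Polytope

/-! ### Graphs of 0/1 linear maps over the standard simplex -/

section GraphSimplex

variable {m : ℕ} (T : Fin m → Fin m → Prop) [DecidableRel T]

/-- The vertices of the simplex of all `(a, b)` where `a` is in the standard simplex and `b k` is
the sum of the coordinates `a i` such that `T i k`. -/
def graphVertex (i : Fin m) : Fin (m + m) → ℤ :=
  Fin.append (Pi.single i 1) fun k => if T i k then 1 else 0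

theorem graphVertex_eq_zero_or_one (i : Fin m) (j : Fin (m + m)) :
    graphVertex T i j = 0 ∨ graphVertex T i j = 1 := by
  refine Fin.addCases (fun k => ?_) (fun k => ?_) j
  · rw [graphVertex, Fin.append_left, Pi.single_apply]; split_ifs <;> simp [-Fin.natAdd_eq_addNat]
  · rw [graphVertex, Fin.append_right]; split_ifs <;> simp [-Fin.natAdd_eq_addNat]

theorem abs_graphVertex_le (i : Fin m) (j : Fin (m + m)) : |graphVertex T i j| ≤ 1 := by
  rcases graphVertex_eq_zero_or_one T i j with h | h <;> simp [-Fin.natAdd_eq_addNat, h]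

/-- The first block of coordinates of a point is its vector of convex weights, so the second block
is determined by it. -/
theorem mem_latticePolytope_graphVertex {x : EuclideanSpace ℝ (Fin (m + m))} :
    x ∈ latticePolytope (graphVertex T) ↔
      (∀ i, 0 ≤ x (Fin.castAdd m i)) ∧ ∑ i, x (Fin.castAdd m i) = 1 ∧
        ∀ k, x (Fin.natAdd m k) = ∑ i, if T i k then x (Fin.castAdd m i) else 0 := by
  rw [mem_latticePolytope]
  constructor
  · rintro ⟨w, hw, hw1, hx⟩
    have hxw : ∀ i, x (Fin.castAdd m i) = w i := fun i => by
      simp [-Fin.natAdd_eq_addNat, hx, graphVertex, Pi.single_apply]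
    refine ⟨by simpa [-Fin.natAdd_eq_addNat, hxw], by simpa [-Fin.natAdd_eq_addNat, hxw], fun k => ?_⟩
    simp [-Fin.natAdd_eq_addNat, hxw, hx, graphVertex]
  · rintro ⟨h0, h1, hk⟩
    refine ⟨fun i => x (Fin.castAdd m i), h0, h1, fun j => ?_⟩
    refine Fin.addCases (fun k => ?_) (fun k => ?_) j
    · simp [-Fin.natAdd_eq_addNat, graphVertex, Pi.single_apply]
    · simp [-Fin.natAdd_eq_addNat, graphVertex, hk]

theorem sum_mul_graphVertex (a : Fin (m + m) → ℤ) (i : Fin m) :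
    ∑ j, a j * graphVertex T i j =
      a (Fin.castAdd m i) + ∑ k, a (Fin.natAdd m k) * if T i k then 1 else 0 := by
  simp [-Fin.natAdd_eq_addNat, Fin.sum_univ_add, graphVertex, Pi.single_apply]

theorem facetComplexity_graphVertex_mem_Icc :
    facetComplexity (latticePolytope (graphVertex T)) ∈ Set.Icc (m + m) (4 * (m + m) + 3) := by
  refine facetComplexity_latticePolytope_mem_Icc fun x hx => ?_
  rw [mem_latticePolytope_graphVertex]
  -- Each equation splits into two inequalities, and every inequality obtained has coefficients in
  -- `{-1, 0, 1}`.
  refine ⟨fun i => ?_, le_antisymm ?_ ?_, fun k => le_antisymm ?_ ?_⟩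
  · have := hx (Fin.append (-Pi.single i 1) 0) 0 (fun j => ?_) (by simp) (fun l => ?_)
    · simpa [-Fin.natAdd_eq_addNat, Fin.sum_univ_add, Pi.single_apply] using this
    · refine Fin.addCases (fun k => ?_) (fun k => ?_) j
      · simp only [Fin.append_left, Pi.neg_apply, Pi.single_apply]; split_ifs <;> simp
      · simp [-Fin.natAdd_eq_addNat]
    · simp only [sum_mul_graphVertex, Fin.append_left, Fin.append_right, Pi.neg_apply,
        Pi.single_apply]
      split_ifs <;> simp
  · have := hx (Fin.append 1 0) 1 (fun j => ?_) (by simp) (fun l => ?_)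
    · simpa [-Fin.natAdd_eq_addNat, Fin.sum_univ_add] using this
    · refine Fin.addCases (fun k => ?_) (fun k => ?_) j <;> simp [-Fin.natAdd_eq_addNat]
    · simp [-Fin.natAdd_eq_addNat, sum_mul_graphVertex]
  · have := hx (Fin.append (-1) 0) (-1) (fun j => ?_) (by simp) (fun l => ?_)
    · simpa [-Fin.natAdd_eq_addNat, Fin.sum_univ_add] using this
    · refine Fin.addCases (fun k => ?_) (fun k => ?_) j <;> simp [-Fin.natAdd_eq_addNat]
    · simp [-Fin.natAdd_eq_addNat, sum_mul_graphVertex]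
  · have := hx (Fin.append (fun i => if T i k then -1 else 0) (Pi.single k 1)) 0
      (fun j => ?_) (by simp) (fun l => ?_)
    · simp [-Fin.natAdd_eq_addNat, Fin.sum_univ_add, Pi.single_apply, Finset.sum_ite] at this ⊢
      linarith
    · refine Fin.addCases (fun k => ?_) (fun k => ?_) j
      · simp only [Fin.append_left]; split_ifs <;> simp
      · simp only [Fin.append_right, Pi.single_apply]; split_ifs <;> simp
    · simp only [sum_mul_graphVertex, Fin.append_left, Fin.append_right, Pi.single_apply, ite_mul,
        one_mul, zero_mul, Finset.sum_ite_eq', Finset.mem_univ, if_true]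
      split_ifs <;> simp
  · have := hx (Fin.append (fun i => if T i k then 1 else 0) (-Pi.single k 1)) 0
      (fun j => ?_) (by simp) (fun l => ?_)
    · simp [-Fin.natAdd_eq_addNat, Fin.sum_univ_add, Pi.single_apply, Finset.sum_ite] at this ⊢
      linarith
    · refine Fin.addCases (fun k => ?_) (fun k => ?_) j
      · simp only [Fin.append_left]; split_ifs <;> simp
      · simp only [Fin.append_right, Pi.neg_apply, Pi.single_apply]; split_ifs <;> simp
    · simp only [sum_mul_graphVertex, Fin.append_left, Fin.append_right, Pi.neg_apply,
        Pi.single_apply, neg_mul, ite_mul, one_mul, zero_mul, Finset.sum_neg_distrib,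
        Finset.sum_ite_eq', Finset.mem_univ, if_true]
      simp

end GraphSimplex

/-! ### Disjointness and distance -/

/-- The simplex of the `(a, a)` and that of the `(a, b)`, where `b` lists the strict partial sums of
`a`, are disjoint: a sequence equal to its own strict partial sums vanishes. -/
theorem disjoint_graphVertex_eq_lt (m : ℕ) :
    Disjoint (latticePolytope (graphVertex fun i k : Fin m => i = k))
      (latticePolytope (graphVertex fun i k : Fin m => i < k)) := by
  rw [Set.disjoint_left]
  intro x hP hQ
  obtain ⟨-, h1, hP⟩ := (mem_latticePolytope_graphVertex _).1 hP
  obtain ⟨-, -, hQ⟩ := (mem_latticePolytope_graphVertex _).1 hQ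
  have h0 : ∀ k : Fin m, x (Fin.castAdd m k) = 0 := by
    intro k
    induction k using WellFoundedLT.induction with
    | ind k ih =>
      have : x (Fin.castAdd m k) = x (Fin.natAdd m k) := by simp [-Fin.natAdd_eq_addNat, hP]
      rw [this, hQ]
      refine Finset.sum_eq_zero fun i _ => ?_
      split_ifs with h
      exacts [ih i h, rfl]
  simp [h0] at h1

/-- Truncated subtraction makes the first two terms both `1`; from then on each term equals the sum
of its predecessors. -/
theorem sum_range_two_pow_pred (k : ℕ) :
    ∑ i ∈ Finset.range (k + 1), (2 : ℝ) ^ (i - 1) = 2 ^ k := by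
  induction k with
  | zero => simp
  | succ k ih => rw [Finset.sum_range_succ, ih, Nat.add_sub_cancel]; ring

theorem setDist_le_dist {d : ℕ} {P Q : Set (EuclideanSpace ℝ (Fin d))}
    {x y : EuclideanSpace ℝ (Fin d)} (hx : x ∈ P) (hy : y ∈ Q) : setDist P Q ≤ dist x y :=
  csInf_le ⟨0, by rintro _ ⟨_, _, _, _, rfl⟩; exact dist_nonneg⟩ ⟨x, hx, y, hy, rfl⟩

theorem setDist_graphVertex_eq_lt_le (m : ℕ) :
    setDist (latticePolytope (graphVertex fun i k : Fin (m + 1) => i = k))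
      (latticePolytope (graphVertex fun i k : Fin (m + 1) => i < k)) ≤ 1 / 2 ^ m := by
  let a : Fin (m + 1) → ℝ := fun k => 2 ^ ((k : ℕ) - 1) / 2 ^ m
  have ha0 : ∀ i, 0 ≤ a i := fun i => by positivity
  have ha1 : ∑ i, a i = 1 := by
    simp only [a]
    rw [← Finset.sum_div, Fin.sum_univ_eq_sum_range (fun i => (2 : ℝ) ^ (i - 1)),
      sum_range_two_pow_pred, div_self (by positivity)]
  let b : Fin (m + 1) → ℝ := fun k => ∑ i, if i < k then a i else 0
  have hb0 : b 0 = 0 := by simp [b]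
  have hb : ∀ k, k ≠ 0 → b k = a k := by
    intro k hk
    obtain ⟨l, hl⟩ := Nat.exists_eq_succ_of_ne_zero (Fin.val_ne_zero_iff.2 hk)
    have h := Fin.sum_univ_eq_sum_range
      (fun i => if i < l + 1 then (2 : ℝ) ^ (i - 1) / 2 ^ m else 0) (m + 1)
    simp only [b, a, Fin.lt_def, hl, Nat.succ_eq_add_one, Nat.add_sub_cancel]
    rw [h, ← Finset.sum_filter]
    have : (Finset.range (m + 1)).filter (· < l + 1) = Finset.range (l + 1) := by
      ext i; have := k.2; simp; omega
    rw [this, ← Finset.sum_div, sum_range_two_pow_pred]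
  let x : EuclideanSpace ℝ (Fin (m + 1 + (m + 1))) := WithLp.toLp 2 (Fin.append a a)
  let y : EuclideanSpace ℝ (Fin (m + 1 + (m + 1))) := WithLp.toLp 2 (Fin.append a b)
  have hx : x ∈ latticePolytope (graphVertex fun i k : Fin (m + 1) => i = k) := by
    rw [mem_latticePolytope_graphVertex]
    simp [-Fin.natAdd_eq_addNat, x, ha0, ha1]
  have hy : y ∈ latticePolytope (graphVertex fun i k : Fin (m + 1) => i < k) := by
    rw [mem_latticePolytope_graphVertex]
    simp [-Fin.natAdd_eq_addNat, y, ha0, ha1, b]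
  refine (setDist_le_dist hx hy).trans ?_
  -- Only the coordinate `k = 0` contributes, where `b` vanishes and `a` is `1 / 2 ^ m`.
  have hs : ∑ k, (a k - b k) ^ 2 = (1 / 2 ^ m) ^ 2 := by
    rw [Finset.sum_eq_single 0 (fun k _ hk => by simp [hb k hk]) (by simp), hb0]
    simp [a]
  rw [EuclideanSpace.dist_eq, Real.sqrt_le_left (by positivity), Fin.sum_univ_add]
  simp [-Fin.natAdd_eq_addNat, x, y, Real.dist_eq, sq_abs, hs]

theorem mainTheorem6 (α : ℝ) (hα₀ : 0 < α) (hα₁ : α < 1) (N : ℕ) :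
    ∃ (d : ℕ) (P Q : Set (EuclideanSpace ℝ (Fin d))),
      IsRationalPolytope P ∧ IsRationalPolytope Q ∧
      HasZeroOneVertices P ∧ HasZeroOneVertices Q ∧
      Disjoint P Q ∧
      N ≤ pairVertexComplexity P Q ∧
      N ≤ pairFacetComplexity P Q ∧
      setDist P Q ≤
        1 / ((pairVertexComplexity P Q : ℝ) / 4) ^
          ((1 - α) * ((pairVertexComplexity P Q : ℝ) / 4) ^ α) ∧
      setDist P Q ≤
        1 / ((pairFacetComplexity P Q : ℝ) / 16) ^
          ((1 - α) / 3 * ((pairFacetComplexity P Q : ℝ) / 16) ^ (α / 3)) := by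
  -- The summand `16` ensures that the bases `ν / 4` and `φ / 16` are at least `1`.
  obtain ⟨m, hm, hmN⟩ := ((eventually_rpow_rpow_le_two_pow hα₁).and
    (Filter.eventually_ge_atTop (N + 16))).exists
  let P := latticePolytope (graphVertex fun i k : Fin (m + 1) => i = k)
  let Q := latticePolytope (graphVertex fun i k : Fin (m + 1) => i < k)
  have hν : pairVertexComplexity P Q ∈ Set.Icc (2 * m + 2) (4 * (2 * m + 2)) := by
    have hP := vertexComplexity_latticePolytope_mem_Icc
      (abs_graphVertex_le fun i k : Fin (m + 1) => i = k)
    have hQ := vertexComplexity_latticePolytope_mem_Icc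
      (abs_graphVertex_le fun i k : Fin (m + 1) => i < k)
    simp only [Set.mem_Icc, pairVertexComplexity, P, Q] at hP hQ ⊢
    omega
  have hφ : pairFacetComplexity P Q ∈ Set.Icc (2 * m + 2) (16 * (2 * m + 2)) := by
    have hP := facetComplexity_graphVertex_mem_Icc fun i k : Fin (m + 1) => i = k
    have hQ := facetComplexity_graphVertex_mem_Icc fun i k : Fin (m + 1) => i < k
    simp only [Set.mem_Icc, pairFacetComplexity, P, Q] at hP hQ ⊢
    omega
  have key : ∀ (n s : ℕ) (c β : ℝ), 0 < s → s ≤ n → n ≤ s * (2 * m + 2) → c ≤ 1 → 0 ≤ β →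
      β ≤ α → setDist P Q ≤ 1 / ((n : ℝ) / s) ^ (c * ((n : ℝ) / s) ^ β) := by
    intro n s c β hs hsn hn hc hβ hβα
    have hs' : (0 : ℝ) < s := by exact_mod_cast hs
    have h1 : 1 ≤ (n : ℝ) / s := by
      rw [le_div_iff₀ hs', one_mul]; exact_mod_cast hsn
    have h2 : (n : ℝ) / s ≤ (2 * m + 2 : ℕ) := by
      rw [div_le_iff₀' hs']; exact_mod_cast hn
    refine (setDist_graphVertex_eq_lt_le m).trans (one_div_le_one_div_of_le (by positivity) ?_)
    exact (rpow_mul_rpow_le_rpow_rpow h1 h2 hc hβ hβα).trans hm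
  refine ⟨m + 1 + (m + 1), P, Q, isRationalPolytope_latticePolytope _,
    isRationalPolytope_latticePolytope _,
    hasZeroOneVertices_latticePolytope (graphVertex_eq_zero_or_one _),
    hasZeroOneVertices_latticePolytope (graphVertex_eq_zero_or_one _),
    disjoint_graphVertex_eq_lt _, ?_, ?_, ?_, ?_⟩
  · have := hν.1; omega
  · have := hφ.1; omega
  · have h := hν.1
    exact_mod_cast key _ 4 (1 - α) α (by norm_num) (by omega) hν.2 (by linarith) hα₀.le le_rfl
  · have h := hφ.1
    exact_mod_cast key _ 16 ((1 - α) / 3) (α / 3) (by norm_num) (by omega) hφ.2 (by linarith)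
      (by linarith) (by linarith)
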